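/- Let $n\ge 0$. An $n$-frame is a nonempty connected undirected graph without loops (multiple edges are allowed), together with an embedding in $\mathbb{R}^{n+1}$, such that: the vertices are points of $\mathbb{R}^{n+1}$; each edge is realised by a simple arc joining its two ends, whose interior contains no vertex and is disjoint from the interiors of the other arcs; the edges are divided into $n$ classes so that every vertex is incident with exactly one edge of each class; and at every vertex the tangent vectors of the $n$ edges issuing from it exist and are linearly independent. A surface spanned on a frame is a cell complex $X$ defined dimension by dimension as follows. The $0$- and $1$-dimensional cells are the vertices and the edges of the frame, which is topologically embedded in $X$ as its $1$-skeleton. In general, for each set $S$ of $k$ classes and each connected component $C$ of the subgraph formed by all vertices and by the edges of the classes in $S$, there is one closed $k$-dimensional cell, homeomorphic to a $k$-dimensional parallelepiped, the homeomorphism carrying the boundary of the parallelepiped onto the union of the $(k-1)$-dimensional cells belonging to the sets $S\setminus\{i\}$, $i\in S$, and to components contained in $C$ (so a $2$-cell is bounded by a cycle of edges of two classes). Any two cells intersect in the union of their common faces, and $X$ is the union of all the cells. Then every surface spanned on an $n$-frame is homeomorphic to the $n$-dimensional simplex. -/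

import Mathlib

open scoped Graph

/-- An `n`-frame: a nonempty connected undirected graph (multiple edges allowed, loops not)
together with an embedding into `ℝⁿ⁺¹`.  The vertices are points of `ℝⁿ⁺¹`, every edge is realised
by a simple arc joining its ends, and the edges are divided into `n` classes such that every vertex
meets exactly one edge of each class and the tangent vectors at a vertex of the `n` edges issuing
from it exist and are linearly independent. -/
structure Frame (n : ℕ) (β : Type*) where
  /-- The underlying multigraph; its vertices are points of `ℝⁿ⁺¹`, its edges are labelled by `β`. -/
  graph : Graph (EuclideanSpace ℝ (Fin (n + 1))) β
  nonempty : V(graph).Nonempty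
  connected : ∀ u ∈ V(graph), ∀ v ∈ V(graph), Relation.ReflTransGen graph.Adj u v
  loopless : ∀ e x, ¬ graph.IsLoopAt e x
  /-- The class of an edge. -/
  color : β → Fin n
  /-- A parametrisation over `[0, 1]` of the arc realising an edge. -/
  arc : β → ℝ → EuclideanSpace ℝ (Fin (n + 1))
  arc_link : ∀ e ∈ E(graph), graph.IsLink e (arc e 0) (arc e 1)
  arc_continuous : ∀ e ∈ E(graph), ContinuousOn (arc e) (Set.Icc 0 1)
  arc_injective : ∀ e ∈ E(graph), Set.InjOn (arc e) (Set.Icc 0 1)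
  /-- The interior of an arc contains no vertex. -/
  arc_vertex : ∀ e ∈ E(graph), Disjoint (arc e '' Set.Ioo 0 1) V(graph)
  /-- Arcs of distinct edges have disjoint interiors. -/
  arc_arc : ∀ e ∈ E(graph), ∀ e' ∈ E(graph), e ≠ e' →
    Disjoint (arc e '' Set.Ioo 0 1) (arc e' '' Set.Ioo 0 1)
  /-- Every vertex meets exactly one edge of each class. -/
  color_unique : ∀ v ∈ V(graph), ∀ i : Fin n, ∃! e, graph.Inc e v ∧ color e = i
  /-- At every vertex `v` the tangent vectors `t i` of the edges issuing from `v` (taken in the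
  direction away from `v`) exist and are linearly independent. -/
  tangent_independent : ∀ v ∈ V(graph), ∃ t : Fin n → EuclideanSpace ℝ (Fin (n + 1)),
    LinearIndependent ℝ t ∧ ∀ e, graph.Inc e v →
      (arc e 0 = v → HasDerivWithinAt (arc e) (t (color e)) (Set.Icc 0 1) 0) ∧
      (arc e 1 = v → HasDerivWithinAt (arc e) (-t (color e)) (Set.Icc 0 1) 1)

namespace Frame

variable {n : ℕ} {β : Type*}

/-- The closed arc in `ℝⁿ⁺¹` realising the edge `e`. -/
def edgeArc (F : Frame n β) (e : β) : Set (EuclideanSpace ℝ (Fin (n + 1))) :=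
  F.arc e '' Set.Icc 0 1

/-- The subset of `ℝⁿ⁺¹` occupied by the frame. -/
def skeleton (F : Frame n β) : Set (EuclideanSpace ℝ (Fin (n + 1))) :=
  V(F.graph) ∪ ⋃ e ∈ E(F.graph), F.edgeArc e

/-- The set of vertices that can be reached from `v` along edges whose classes belong to `S`, that
is, the connected component of `v` in the subgraph formed by the edges of the classes in `S`. -/
def comp (F : Frame n β) (S : Finset (Fin n)) (v : EuclideanSpace ℝ (Fin (n + 1))) :
    Set (EuclideanSpace ℝ (Fin (n + 1))) :=
  {u | Relation.ReflTransGen (fun x y => ∃ e, F.graph.IsLink e x y ∧ F.color e ∈ S) v u}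

end Frame

/-- The boundary of the unit cube `[0, 1]^ι`: the union of its facets. -/
def cubeBoundary (ι : Type*) : Set (ι → unitInterval) :=
  {x | ∃ i, x i = 0 ∨ x i = 1}

/-- `X` is a surface spanned on the frame `F`: a cell complex whose one-dimensional skeleton is the
frame, with one `k`-dimensional cell for every set `S` of `k` classes and every connected component
of the subgraph formed by the edges of these classes.  Each cell is homeomorphic to a
`k`-dimensional parallelepiped, and the boundary of the parallelepiped corresponds to the
`(k-1)`-dimensional complex formed by the cells of the `(k-1)`-element subsets of `S` inside the
component. The space `X` is the union of the cells.  No embedding of `X` in `ℝⁿ⁺¹` is required,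
but the surfaces contained in `ℝⁿ⁺¹` are included (`X` a subspace and `incl` the inclusion). -/
structure SpannedSurface {n : ℕ} {β : Type*} (F : Frame n β) (X : Type*) [TopologicalSpace X] where
  /-- The inclusion of the frame in the surface. -/
  incl : F.skeleton → X
  isEmbedding_incl : Topology.IsEmbedding incl
  /-- `cell S v` is the closed cell spanned on the component of `v` in the subgraph formed by the
  edges of the classes in `S` (only its values at vertices `v` matter). -/
  cell : Finset (Fin n) → EuclideanSpace ℝ (Fin (n + 1)) → Set X
  /-- The cell depends only on the component. -/
  cell_congr : ∀ S, ∀ v ∈ V(F.graph), ∀ u ∈ F.comp S v, cell S u = cell S v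
  /-- The zero-dimensional cells are the vertices of the frame. -/
  cell_vertex : ∀ v ∈ V(F.graph), cell ∅ v = incl '' {x | (x : EuclideanSpace ℝ (Fin (n + 1))) = v}
  /-- The one-dimensional cells are the edges of the frame. -/
  cell_edge : ∀ v ∈ V(F.graph), ∀ e, F.graph.Inc e v →
    cell {F.color e} v = incl '' {x | (x : EuclideanSpace ℝ (Fin (n + 1))) ∈ F.edgeArc e}
  /-- Every cell is homeomorphic to a parallelepiped, with boundary the lower-dimensional complex. -/
  exists_homeomorph : ∀ S : Finset (Fin n), ∀ v ∈ V(F.graph),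
    ∃ h : (↥S → unitInterval) ≃ₜ ↥(cell S v), (fun x => (h x : X)) '' cubeBoundary ↥S =
      ⋃ i ∈ S, ⋃ u ∈ F.comp S v, cell (S.erase i) u
  /-- Any two cells intersect in the union of their common faces. -/
  cell_inter : ∀ S T : Finset (Fin n), ∀ v ∈ V(F.graph), ∀ w ∈ V(F.graph), cell S v ∩ cell T w =
    ⋃ R ⊆ S ∩ T, ⋃ u ∈ F.comp S v ∩ F.comp T w, cell R u
  /-- The surface is the union of its cells. -/
  iUnion_cell : ⋃ S, ⋃ v ∈ V(F.graph), cell S v = Set.univ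

/-! Connectedness leaves only one component when all `n` classes are used, hence only one `n`-cell.
Every other cell lies in it, because enlarging the set of classes by one makes a cell a part of the
boundary of the next (`cell_subset_cell`). So the surface is this single cell (`cell_univ`), a cube.
The cube and the simplex are homeomorphic as convex bodies; since `stdSimplex` has empty interior in
its ambient space, it is first projected to `cornerSimplex`, which is full-dimensional. -/

/-- The convex hull of the origin and the standard basis vectors. -/
def cornerSimplex (n : ℕ) : Set (Fin n → ℝ) :=
  {x | (∀ i, 0 ≤ x i) ∧ ∑ i, x i ≤ 1}

theorem convex_cornerSimplex (n : ℕ) : Convex ℝ (cornerSimplex n) := by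
  rintro x ⟨hx, hx'⟩ y ⟨hy, hy'⟩ a b ha hb hab
  refine ⟨fun i => ?_, ?_⟩
  · have := mul_nonneg ha (hx i)
    have := mul_nonneg hb (hy i)
    simp only [Pi.add_apply, Pi.smul_apply, smul_eq_mul]
    linarith
  · simp only [Pi.add_apply, Pi.smul_apply, smul_eq_mul, Finset.sum_add_distrib, ← Finset.mul_sum]
    have := mul_le_mul_of_nonneg_left hx' ha
    have := mul_le_mul_of_nonneg_left hy' hb
    linarith

theorem isClosed_cornerSimplex (n : ℕ) : IsClosed (cornerSimplex n) := by
  have h : cornerSimplex n = (⋂ i, {x | 0 ≤ x i}) ∩ {x | ∑ i, x i ≤ 1} := by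
    ext x
    simp [cornerSimplex]
  rw [h]
  exact (isClosed_iInter fun i => isClosed_le continuous_const (continuous_apply i)).inter
    (isClosed_le (by fun_prop) continuous_const)

theorem cornerSimplex_subset_Icc (n : ℕ) : cornerSimplex n ⊆ Set.Icc 0 1 := fun _ hx =>
  ⟨hx.1, fun i =>
    (Finset.single_le_sum (fun j _ => hx.1 j) (Finset.mem_univ i)).trans hx.2⟩

theorem interior_cornerSimplex_nonempty (n : ℕ) : (interior (cornerSimplex n)).Nonempty := by
  have hn : (0 : ℝ) < n + 1 := by positivity
  -- The barycentre: its coordinate sum is n/(n+1) < 1, also for n = 0.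
  refine ⟨fun _ => 1 / ((n : ℝ) + 1), mem_interior.2
    ⟨(⋂ i, {x | 0 < x i}) ∩ {x | ∑ i, x i < 1}, ?_, ?_, ?_, ?_⟩⟩
  · rintro x ⟨hx, hx'⟩
    exact ⟨fun i => (Set.mem_iInter.1 hx i).le, le_of_lt hx'⟩
  · exact (isOpen_iInter_of_finite fun i => isOpen_lt continuous_const (continuous_apply i)).inter
      (isOpen_lt (by fun_prop) continuous_const)
  · exact Set.mem_iInter.2 fun _ => one_div_pos.2 hn
  · simp only [Set.mem_ofPred_eq, Finset.sum_const, Finset.card_univ, Fintype.card_fin, nsmul_eq_mul]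
    rw [mul_one_div, div_lt_one hn]
    linarith

/-- Convex bodies in a normed space are homeomorphic. -/
theorem Convex.nonempty_homeomorph {E : Type*} [NormedAddCommGroup E] [NormedSpace ℝ E]
    {s t : Set E} (hs : Convex ℝ s) (hsc : IsClosed s) (hsi : (interior s).Nonempty)
    (hsb : Bornology.IsBounded s) (ht : Convex ℝ t) (htc : IsClosed t)
    (hti : (interior t).Nonempty) (htb : Bornology.IsBounded t) : Nonempty (s ≃ₜ t) := by
  obtain ⟨e, -, he, -⟩ := exists_homeomorph_image_eq hs hsi
    (NormedSpace.isVonNBounded_of_isBounded ℝ hsb) ht hti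
    (NormedSpace.isVonNBounded_of_isBounded ℝ htb)
  rw [hsc.closure_eq, htc.closure_eq] at he
  exact ⟨(e.image s).trans (Homeomorph.setCongr he)⟩

/-- Forgetting the first barycentric coordinate. -/
def stdSimplexHomeomorphCornerSimplex (n : ℕ) :
    stdSimplex ℝ (Fin (n + 1)) ≃ₜ cornerSimplex n where
  toFun x := ⟨fun i => x.1 i.succ, fun i => x.2.1 _, by
    have h := x.2.2
    rw [Fin.sum_univ_succ] at h
    have := x.2.1 0
    linarith⟩
  invFun y := ⟨Fin.cons (1 - ∑ i, y.1 i) y.1,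
    fun i => Fin.cases (by simpa using y.2.2) (by simpa using y.2.1) i, by
      simp [Fin.sum_univ_succ]⟩
  left_inv x := by
    have h := x.2.2
    rw [Fin.sum_univ_succ] at h
    refine Subtype.ext (funext fun i => ?_)
    cases i using Fin.cases with
    | zero => simpa using by linarith
    | succ i => simp
  right_inv y := by
    ext i
    simp
  continuous_toFun := Continuous.subtype_mk
    (continuous_pi fun i => (continuous_apply i.succ).comp continuous_subtype_val) _
  continuous_invFun := by
    refine Continuous.subtype_mk (continuous_pi fun i => ?_) _
    cases i using Fin.cases with
    | zero =>
      simp only [Fin.cons_zero]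
      fun_prop
    | succ i =>
      exact (continuous_apply i).comp continuous_subtype_val

/-- A product of unit intervals as a box in the ambient product of lines. -/
def unitCubeHomeomorphIcc (ι : Type*) :
    (ι → unitInterval) ≃ₜ (Set.Icc 0 1 : Set (ι → ℝ)) where
  toFun x := ⟨fun i => x i, fun i => (x i).2.1, fun i => (x i).2.2⟩
  invFun y i := ⟨y.1 i, y.2.1 i, y.2.2 i⟩
  left_inv _ := rfl
  right_inv _ := rfl
  continuous_toFun := by fun_prop
  continuous_invFun := continuous_pi fun i =>
    ((continuous_apply i).comp continuous_subtype_val).subtype_mk _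

theorem nonempty_unitCube_homeomorph_stdSimplex (n : ℕ) :
    Nonempty ((Fin n → unitInterval) ≃ₜ stdSimplex ℝ (Fin (n + 1))) := by
  have hb : Bornology.IsBounded (Set.Icc 0 1 : Set (Fin n → ℝ)) := Metric.isBounded_Icc 0 1
  obtain ⟨e⟩ := (convex_Icc (0 : Fin n → ℝ) 1).nonempty_homeomorph isClosed_Icc
    ((interior_cornerSimplex_nonempty n).mono (interior_mono (cornerSimplex_subset_Icc n))) hb
    (convex_cornerSimplex n) (isClosed_cornerSimplex n) (interior_cornerSimplex_nonempty n)
    (hb.subset (cornerSimplex_subset_Icc n))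
  exact ⟨(unitCubeHomeomorphIcc (Fin n)).trans
    (e.trans (stdSimplexHomeomorphCornerSimplex n).symm)⟩

/-- The only place where connectedness of the frame enters. -/
theorem Frame.mem_comp_univ {n : ℕ} {β : Type*} (F : Frame n β)
    {u v : EuclideanSpace ℝ (Fin (n + 1))} (hu : u ∈ V(F.graph)) (hv : v ∈ V(F.graph)) :
    u ∈ F.comp Finset.univ v :=
  Relation.ReflTransGen.mono (p := fun x y => ∃ e, F.graph.IsLink e x y ∧ F.color e ∈ Finset.univ)
    (fun _ _ ⟨e, he⟩ => ⟨e, he, Finset.mem_univ _⟩) _ _ (F.connected v hv u hu)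

namespace SpannedSurface

variable {n : ℕ} {β : Type*} {F : Frame n β} {X : Type*} [TopologicalSpace X]

/-- A facet of a cell is contained in it. -/
theorem cell_subset_cell_insert (K : SpannedSurface F X) (S : Finset (Fin n)) {i : Fin n}
    (hi : i ∉ S) {v : EuclideanSpace ℝ (Fin (n + 1))} (hv : v ∈ V(F.graph)) :
    K.cell S v ⊆ K.cell (insert i S) v := by
  obtain ⟨h, hh⟩ := K.exists_homeomorph (insert i S) v hv
  intro x hx
  have hx' : x ∈ ⋃ j ∈ insert i S, ⋃ u ∈ F.comp (insert i S) v, K.cell ((insert i S).erase j) u :=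
    Set.mem_biUnion (Finset.mem_insert_self i S)
      (Set.mem_biUnion (Relation.ReflTransGen.refl) (by rwa [Finset.erase_insert hi]))
  rw [← hh] at hx'
  obtain ⟨y, -, rfl⟩ := hx'
  exact (h y).2

theorem cell_subset_cell (K : SpannedSurface F X) {S T : Finset (Fin n)} (hST : S ⊆ T)
    {v : EuclideanSpace ℝ (Fin (n + 1))} (hv : v ∈ V(F.graph)) : K.cell S v ⊆ K.cell T v := by
  -- Classes are added one at a time at a fixed vertex; taking `R = T` gives the claim.
  have key (R : Finset (Fin n)) : K.cell S v ⊆ K.cell (R ∪ S) v := by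
    induction R using Finset.induction_on with
    | empty => rw [Finset.empty_union]
    | insert i R _ ih =>
      rw [Finset.insert_union]
      by_cases hi : i ∈ R ∪ S
      · rwa [Finset.insert_eq_of_mem hi]
      · exact ih.trans (K.cell_subset_cell_insert _ hi hv)
  simpa [Finset.union_eq_left.2 hST] using key T

/-- The surface is its top-dimensional cell. -/
theorem cell_univ (K : SpannedSurface F X) {v : EuclideanSpace ℝ (Fin (n + 1))}
    (hv : v ∈ V(F.graph)) : K.cell Finset.univ v = Set.univ := by
  rw [Set.eq_univ_iff_forall]
  intro x
  have hx : x ∈ ⋃ S, ⋃ v ∈ V(F.graph), K.cell S v := K.iUnion_cell ▸ Set.mem_univ x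
  simp only [Set.mem_iUnion] at hx
  obtain ⟨S, u, hu, hx⟩ := hx
  -- Rebase the top cell at `u`, the vertex whose cell contains `x`.
  rw [← K.cell_congr Finset.univ v hv u (F.mem_comp_univ hu hv)]
  exact K.cell_subset_cell (Finset.subset_univ S) hu hx

end SpannedSurface

theorem mainTheorem4 {n : ℕ} {β : Type*} (F : Frame n β) {X : Type*} [TopologicalSpace X]
    (K : SpannedSurface F X) : Nonempty (X ≃ₜ stdSimplex ℝ (Fin (n + 1))) := by
  obtain ⟨v, hv⟩ := F.nonempty
  obtain ⟨h, -⟩ := K.exists_homeomorph Finset.univ v hv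
  obtain ⟨e⟩ := nonempty_unitCube_homeomorph_stdSimplex n
  -- The cell's coordinates are indexed by the subtype of `Finset.univ`, so they are relabelled by
  -- `Fin n`.
  let c : (↥(Finset.univ : Finset (Fin n)) → unitInterval) ≃ₜ (Fin n → unitInterval) :=
    Homeomorph.piCongrLeft (Y := fun _ => unitInterval) (Equiv.subtypeUnivEquiv Finset.mem_univ)
  exact ⟨(Homeomorph.Set.univ X).symm.trans
    ((Homeomorph.setCongr (K.cell_univ hv).symm).trans (h.symm.trans (c.trans e)))⟩
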